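/- Let $N\ge 1$, let $2<p_1\le p_2\le\cdots\le p_N$ be real numbers, and put $q=\frac1N\sum_{i=1}^N p_i$. Let $g\in L^1_{loc}(\mathbb{R}^N)$ satisfy $g\ge c$ a.e. for some constant $c>0$, and let $f(t)=-e^{1/t}$ for $t>0$. Let $W^{1,p_i}_{loc}(\mathbb{R}^N)$ be the set of all $u\in L^1_{loc}(\mathbb{R}^N)$ having weak partial derivatives $u_i=\partial u/\partial x_i\in L^1_{loc}(\mathbb{R}^N)$ with $u_i\in L^{p_i}_{loc}(\mathbb{R}^N)$ for $i=1,\dots,N$. A function $u\in W^{1,p_i}_{loc}(\mathbb{R}^N)$ is called a stable solution of $$-\sum_{i=1}^N\frac{\partial}{\partial x_i}\left(|u_i|^{p_i-2}u_i\right)=g(x)f(u),\quad u>0,\quad\text{in }\mathbb{R}^N \tag{1}$$ if $u>0$ a.e., $g f(u)$ and $g f'(u)$ belong to $L^1_{loc}(\mathbb{R}^N)$, and for all $\varphi\in C_c^1(\mathbb{R}^N)$ $$\sum_{i=1}^N\int_{\mathbb{R}^N}|u_i|^{p_i-2}u_i\frac{\partial\varphi}{\partial x_i}\,dx=\int_{\mathbb{R}^N}g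 f(u)\varphi\,dx$$ and $$\int_{\mathbb{R}^N}g f'(u)\varphi^2\,dx\le\sum_{i=1}^N(p_i-1)\int_{\mathbb{R}^N}|u_i|^{p_i-2}\left|\frac{\partial\varphi}{\partial x_i}\right|^2dx .$$ **Theorem.** Suppose that $$M\in J=\left(0,\frac{4}{N(q-1)(p_N-1)}\right)\cap\left(0,\frac{4}{N(N-1)(q-1)}\right),$$ where the second interval is read as $(0,\infty)$ if $N=1$. If $u\in W^{1,p_i}_{loc}(\mathbb{R}^N)$ satisfies $0<u\le M$ a.e. in $\mathbb{R}^N$, then $u$ is not a stable solution of (1). -/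

import Mathlib

open MeasureTheory
open scoped ContDiff

/-- `ℝᴺ` with its Euclidean norm and Lebesgue measure. -/
abbrev RN (N : ℕ) : Type := EuclideanSpace ℝ (Fin N)

/-- The classical `i`-th partial derivative `∂φ/∂xᵢ` of a differentiable function `φ`. -/
noncomputable def partialDeriv {N : ℕ} (i : Fin N) (φ : RN N → ℝ) (x : RN N) : ℝ :=
  fderiv ℝ φ x (EuclideanSpace.single i 1)

/-- `v` is the weak (distributional) partial derivative `∂u/∂xᵢ` of `u` on `ℝᴺ`, both being
locally integrable. -/
def IsWeakPartialDeriv {N : ℕ} (i : Fin N) (u v : RN N → ℝ) : Prop :=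
  LocallyIntegrable u volume ∧ LocallyIntegrable v volume ∧
    ∀ φ : RN N → ℝ, ContDiff ℝ ∞ φ → HasCompactSupport φ →
      ∫ x, u x * partialDeriv i φ x = -∫ x, v x * φ x

/-- `v ∈ L^r_loc(ℝᴺ)`, for a real exponent `r`. -/
def MemLpLoc {N : ℕ} (r : ℝ) (v : RN N → ℝ) : Prop :=
  ∀ K : Set (RN N), IsCompact K → MemLp v (ENNReal.ofReal r) (volume.restrict K)

/-- `u ∈ W^{1,1}_loc(ℝᴺ)` with weak gradient `(Du 0, …, Du (N - 1))`, and `Du i ∈ L^{pᵢ}_loc(ℝᴺ)`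
for every `i`. -/
def HasAnisoGradient {N : ℕ} (p : Fin N → ℝ) (u : RN N → ℝ) (Du : Fin N → RN N → ℝ) : Prop :=
  LocallyIntegrable u volume ∧ ∀ i, IsWeakPartialDeriv i u (Du i) ∧ MemLpLoc (p i) (Du i)

/-- The local anisotropic Sobolev space `W^{1,pᵢ}_loc(ℝᴺ)`. -/
def AnisoSobolevLoc {N : ℕ} (p : Fin N → ℝ) : Set (RN N → ℝ) :=
  {u | ∃ Du : Fin N → RN N → ℝ, HasAnisoGradient p u Du}

/-- `u` is a stable solution of
`-∑ᵢ ∂/∂xᵢ (|∂u/∂xᵢ|^(pᵢ-2) ∂u/∂xᵢ) = g(x) f(u)`, `u > 0`, in `ℝᴺ`: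
it lies in `W^{1,pᵢ}_loc(ℝᴺ)`, is positive a.e., `g f(u)` and `g f'(u)` are locally integrable,
and the weak formulation and the stability inequality hold for all `φ ∈ C_c¹(ℝᴺ)`.
The weak gradient `Du` is unique up to null sets, so it does not matter which one is used. -/
def IsStableSolution {N : ℕ} (p : Fin N → ℝ) (g : RN N → ℝ) (f : ℝ → ℝ) (u : RN N → ℝ) : Prop :=
  ∃ Du : Fin N → RN N → ℝ, HasAnisoGradient p u Du ∧
    (∀ᵐ x, 0 < u x) ∧
    LocallyIntegrable (fun x => g x * f (u x)) volume ∧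
    LocallyIntegrable (fun x => g x * deriv f (u x)) volume ∧
    (∀ φ : RN N → ℝ, ContDiff ℝ 1 φ → HasCompactSupport φ →
      ∑ i, ∫ x, |Du i x| ^ (p i - 2) * Du i x * partialDeriv i φ x =
        ∫ x, g x * f (u x) * φ x) ∧
    (∀ φ : RN N → ℝ, ContDiff ℝ 1 φ → HasCompactSupport φ →
      ∫ x, g x * deriv f (u x) * φ x ^ 2 ≤
        ∑ i, (p i - 1) * ∫ x, |Du i x| ^ (p i - 2) * |partialDeriv i φ x| ^ 2)

/-- The nonlinearity `f(t) = -e^{1/t}`; only its values at `t > 0` matter. -/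
noncomputable def negExpInv (t : ℝ) : ℝ := -Real.exp (1 / t)

/-- The arithmetic mean `q = (p₁ + ⋯ + p_N) / N` of the exponents. -/
noncomputable def meanExponent {N : ℕ} (p : Fin N → ℝ) : ℝ := (∑ i, p i) / N

/-- The interval `B = (0, 4 / (N (q - 1) (p_N - 1)))`, where `r = p_N`. -/
noncomputable def intervalB (N : ℕ) (q r : ℝ) : Set ℝ :=
  Set.Ioo 0 (4 / (N * (q - 1) * (r - 1)))

/-- The interval `C = (0, 4 / (N (N - 1) (q - 1)))`; its right end is `4 / 0 = ∞` if `N = 1`. -/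
noncomputable def intervalC (N : ℕ) (q : ℝ) : Set ℝ :=
  if N = 1 then Set.Ioi 0 else Set.Ioo 0 (4 / (N * ((N : ℝ) - 1) * (q - 1)))

/-- `J = B ∩ C`, where `r = p_N`. -/
noncomputable def intervalJ (N : ℕ) (q r : ℝ) : Set ℝ := intervalB N q r ∩ intervalC N q

open Filter Topology ContinuousLinearMap

theorem continuous_integral_mul_translate {N : ℕ} {p q : ENNReal} [ENNReal.HolderConjugate p q]
    (hq : q ≠ ⊤) {G h : RN N → ℝ} (hG : MemLp G p volume) (hh : MemLp h q volume) :
    Continuous fun y : RN N => ∫ x, G x * h (y + x) := by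
  have : Fact (1 ≤ q) := ⟨ENNReal.HolderConjugate.one_le q p⟩
  have : Fact (1 ≤ p) := ⟨ENNReal.HolderConjugate.one_le p q⟩
  have : Fact (q ≠ ⊤) := ⟨hq⟩
  have key : ∀ y : RN N, ∫ x, G x * h (y + x) =
      (ContinuousLinearMap.mul ℝ ℝ).lpPairing volume p q (hG.toLp G)
        (DomAddAct.mk y +ᵥ hh.toLp h) := by
    intro y
    rw [ContinuousLinearMap.lpPairing_eq_integral]
    refine integral_congr_ae ?_
    rw [DomAddAct.mk_vadd_toLp]
    filter_upwards [hG.coeFn_toLp, MemLp.coeFn_toLp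
      (hh.comp_measurePreserving (measurePreserving_vadd y volume))] with x h1 h2
    rw [h1]
    exact congrArg (G x * ·) h2.symm
  simp_rw [key]
  refine (ContinuousLinearMap.continuous _).comp ?_
  exact (DomAddAct.continuous_mk.vadd continuous_const)

theorem integral_mul_normed_convolution {N : ℕ} (ρ : ContDiffBump (0 : RN N))
    {G h : RN N → ℝ} (hG : Integrable G volume) (hh : Integrable h volume) :
    ∫ x, G x * (convolution (ρ.normed volume) h (lsmul ℝ ℝ) volume) x =
      convolution (ρ.normed volume) (fun y => ∫ x, G x * h (y + x)) (lsmul ℝ ℝ) volume 0 := by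
  have hint : Integrable (fun z : RN N × RN N => ρ.normed volume z.1 * (G z.2 * h (z.2 - z.1)))
      (volume.prod volume) := by
    have h2 := hG.convolution_integrand (lsmul ℝ ℝ) hh.comp_neg
    simp only [neg_sub] at h2
    obtain ⟨C, hC⟩ := (ρ.hasCompactSupport_normed (μ := volume)).exists_bound_of_continuous
      ρ.continuous_normed
    exact h2.bdd_mul (c := C) (ρ.continuous_normed.comp continuous_fst).aestronglyMeasurable
      (Eventually.of_forall fun z => hC z.1)
  have h3 := integral_integral_swap (μ := (volume : Measure (RN N)))
    (ν := (volume : Measure (RN N)))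
    (f := fun y x => ρ.normed volume y * (G x * h (x - y))) hint
  simp only [convolution, lsmul_apply, smul_eq_mul, zero_sub]
  calc _ = ∫ x, ∫ y, ρ.normed volume y * (G x * h (x - y)) := by
        refine integral_congr_ae (Eventually.of_forall fun x => ?_)
        simp only [← integral_const_mul]
        exact integral_congr_ae (Eventually.of_forall fun y => by ring)
    _ = _ := by
        rw [← h3]
        refine integral_congr_ae (Eventually.of_forall fun y => ?_)
        simp only [integral_const_mul, neg_add_eq_sub]

theorem tendsto_integral_mul_normed_convolution {N : ℕ} {p q : ENNReal}
    [ENNReal.HolderConjugate p q] (hq : q ≠ ⊤) {G h : RN N → ℝ}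
    (hG : MemLp G p volume) (hh : MemLp h q volume) (hG1 : Integrable G volume)
    (hh1 : Integrable h volume) {ρ : ℕ → ContDiffBump (0 : RN N)}
    (hρ : Tendsto (fun n => (ρ n).rOut) atTop (𝓝 0)) :
    Tendsto (fun n => ∫ x, G x * (convolution ((ρ n).normed volume) h (lsmul ℝ ℝ) volume) x)
      atTop (𝓝 (∫ x, G x * h x)) := by
  have := ContDiffBump.convolution_tendsto_right_of_continuous (μ := volume) hρ
    (continuous_integral_mul_translate hq hG hh) 0
  simp only [zero_add] at this
  exact this.congr fun n => (integral_mul_normed_convolution (ρ n) hG1 hh1).symm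

theorem MeasureTheory.MemLp.abs_rpow_mul_self {α : Type*} [MeasurableSpace α] {μ : Measure α} {r : ℝ}
    (hr : 2 < r) {v : α → ℝ} (hv : MemLp v (ENNReal.ofReal r) μ) :
    MemLp (fun x => |v x| ^ (r - 2) * v x) (ENNReal.ofReal (r / (r - 1))) μ := by
  have h := hv.norm_rpow_div (ENNReal.ofReal (r - 1))
  rw [← ENNReal.ofReal_div_of_pos (by linarith), ENNReal.toReal_ofReal (by linarith)] at h
  refine h.congr_norm ?_ (Eventually.of_forall fun x => ?_)
  · exact ((hv.1.aemeasurable.abs.pow_const _).mul hv.1.aemeasurable).aestronglyMeasurable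
  · simp only [Real.norm_eq_abs, abs_mul, Real.abs_rpow_of_nonneg (abs_nonneg _), abs_abs]
    rcases eq_or_ne (v x) 0 with h0 | h0
    · simp [h0, Real.zero_rpow (show r - 1 ≠ 0 by linarith)]
    · rw [← Real.rpow_add_one (abs_ne_zero.2 h0)]; ring_nf

theorem partialDeriv_normed_convolution {N : ℕ} (ρ : ContDiffBump (0 : RN N)) {i : Fin N}
    {u v : RN N → ℝ} (h : IsWeakPartialDeriv i u v) (x : RN N) :
    partialDeriv i (convolution (ρ.normed volume) u (lsmul ℝ ℝ) volume) x =
      convolution (ρ.normed volume) v (lsmul ℝ ℝ) volume x := by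
  obtain ⟨hu, hv, hφ⟩ := h
  have hd := ρ.hasCompactSupport_normed (μ := volume) |>.hasFDerivAt_convolution_left
    (lsmul ℝ ℝ) (ρ.contDiff_normed (n := 1)) hu x
  have hc : HasCompactSupport (fun y => ρ.normed volume (x - y)) :=
    ρ.hasCompactSupport_normed.comp_homeomorph (Homeomorph.subLeft x)
  have hs : ContDiff ℝ ∞ (fun y => ρ.normed volume (x - y)) :=
    ρ.contDiff_normed.comp (contDiff_const.sub contDiff_id)
  have hw := hφ _ hs hc
  have hpd : ∀ y, partialDeriv i (fun y => ρ.normed volume (x - y)) y =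
      -partialDeriv i (ρ.normed volume) (x - y) := by
    intro y
    have hρ : DifferentiableAt ℝ (ρ.normed volume) (x - y) :=
      (ρ.contDiff_normed (n := 1)).differentiable one_ne_zero _
    have := hρ.hasFDerivAt.comp y ((hasFDerivAt_id y).const_sub x)
    simp only [partialDeriv]
    rw [HasFDerivAt.fderiv (f := fun y => ρ.normed volume (x - y)) this]
    simp
  simp only [hpd, mul_neg, integral_neg, neg_inj] at hw
  have hcs : HasCompactSupport (fun t => fderiv ℝ (ρ.normed volume) (x - t)) :=
    (ρ.hasCompactSupport_normed.fderiv (𝕜 := ℝ)).comp_homeomorph (Homeomorph.subLeft x)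
  have hct : Continuous (fun t => fderiv ℝ (ρ.normed volume) (x - t)) :=
    ((ρ.contDiff_normed (n := 1)).continuous_fderiv one_ne_zero).comp (by fun_prop)
  have hci : Integrable (fun t => u t • fderiv ℝ (ρ.normed volume) (x - t)) :=
    hu.integrable_smul_right_of_hasCompactSupport hct hcs
  have heq : ∀ t, (lsmul ℝ ℝ).precompL (RN N) (fderiv ℝ (ρ.normed volume) (x - t)) (u t) =
      u t • fderiv ℝ (ρ.normed volume) (x - t) := by
    intro t
    ext y
    simp [mul_comm]
  rw [partialDeriv, hd.fderiv, convolution_eq_swap, convolution_eq_swap]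
  simp_rw [heq]
  rw [ContinuousLinearMap.integral_apply hci]
  simp only [partialDeriv] at hw
  simpa only [smul_apply, smul_eq_mul, lsmul_apply, mul_comm] using hw

theorem memLp_mul_of_hasCompactSupport {N : ℕ} {q : ENNReal} {v ζ : RN N → ℝ}
    (hv : ∀ K : Set (RN N), IsCompact K → MemLp v q (volume.restrict K))
    (hζ : Continuous ζ) (hc : HasCompactSupport ζ) :
    MemLp (fun x => v x * ζ x) q volume := by
  obtain ⟨C, hC⟩ := hc.exists_bound_of_continuous hζ
  have hK : MeasurableSet (tsupport ζ) := (isClosed_tsupport ζ).measurableSet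
  have h1 : MemLp (fun x => v x * ζ x) q (volume.restrict (tsupport ζ)) := by
    refine (hv _ hc).of_le_mul (c := C) ((hv _ hc).1.mul hζ.aestronglyMeasurable)
      (Eventually.of_forall fun x => ?_)
    rw [norm_mul, mul_comm]
    exact mul_le_mul_of_nonneg_right (hC x) (norm_nonneg _)
  rw [← memLp_indicator_iff_restrict hK] at h1
  refine h1.ae_eq (Eventually.of_forall fun x => ?_)
  by_cases hx : x ∈ tsupport ζ
  · simp [hx]
  · simp [hx, image_eq_zero_of_notMem_tsupport hx]

theorem normed_convolution_congr {N : ℕ} (ρ : ContDiffBump (0 : RN N)) {v w : RN N → ℝ} {x : RN N}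
    (h : ∀ y ∈ Metric.ball x ρ.rOut, v y = w y) :
    convolution (ρ.normed volume) v (lsmul ℝ ℝ) volume x =
      convolution (ρ.normed volume) w (lsmul ℝ ℝ) volume x := by
  refine integral_congr_ae (Eventually.of_forall fun t => ?_)
  by_cases ht : t ∈ Metric.ball (0 : RN N) ρ.rOut
  · simp only [lsmul_apply, smul_eq_mul]
    rw [h (x - t) (by simpa [Metric.mem_ball, dist_eq_norm] using ht)]
  · rw [← ρ.support_normed_eq (μ := volume)] at ht
    simp [Function.notMem_support.1 ht]

theorem normed_convolution_mem_Icc {N : ℕ} (ρ : ContDiffBump (0 : RN N)) {u : RN N → ℝ} {M : ℝ}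
    (hu : LocallyIntegrable u volume) (h0 : ∀ᵐ x, 0 < u x) (hM : ∀ᵐ x, u x ≤ M) (x : RN N) :
    convolution (ρ.normed volume) u (lsmul ℝ ℝ) volume x ∈ Set.Icc 0 M := by
  have hq := (Measure.measurePreserving_sub_left (volume : Measure (RN N)) x).quasiMeasurePreserving
  have hi : Integrable (fun t => ρ.normed volume t * u (x - t)) :=
    ρ.hasCompactSupport_normed.convolutionExists_left (lsmul ℝ ℝ) ρ.continuous_normed hu x
  constructor
  · refine integral_nonneg_of_ae ?_
    filter_upwards [hq.ae h0] with t ht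
    exact mul_nonneg (ρ.nonneg_normed t) ht.le
  · calc _ ≤ ∫ t, ρ.normed volume t * M := by
          refine integral_mono_ae hi (ρ.integrable_normed.mul_const M) ?_
          filter_upwards [hq.ae hM] with t ht
          exact mul_le_mul_of_nonneg_left ht (ρ.nonneg_normed t)
      _ = M := by rw [integral_mul_const, ρ.integral_normed, one_mul]

theorem locallyIntegrable_of_memLp_restrict {N : ℕ} {q : ENNReal} (hq : 1 ≤ q) {v : RN N → ℝ}
    (hv : ∀ K : Set (RN N), IsCompact K → MemLp v q (volume.restrict K)) :
    LocallyIntegrable v volume := by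
  rw [locallyIntegrable_iff]
  intro K hK
  have : IsFiniteMeasure (volume.restrict K) := ⟨by simpa using hK.measure_lt_top⟩
  exact (hv K hK).integrable hq

theorem holderConjugate_ofReal {r : ℝ} (hr : 1 < r) :
    ENNReal.HolderConjugate (ENNReal.ofReal (r / (r - 1))) (ENNReal.ofReal r) :=
  (Real.HolderConjugate.conjExponent hr).symm.ennrealOfReal

theorem abs_rpow_mul_mul_self {r : ℝ} (hr : 0 < r) (a : ℝ) :
    |a| ^ (r - 2) * a * a = |a| ^ r := by
  rcases eq_or_ne a 0 with rfl | ha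
  · simp [Real.zero_rpow hr.ne']
  · rw [mul_assoc, ← abs_mul_abs_self a, ← mul_assoc, ← Real.rpow_add_one (abs_ne_zero.2 ha),
      ← Real.rpow_add_one (abs_ne_zero.2 ha)]
    ring_nf

theorem tendsto_integral_flux_mul_normed_convolution {N : ℕ} {r : ℝ} (hr : 2 < r)
    {v ζ : RN N → ℝ} (hv : MemLpLoc r v) (hζ : Continuous ζ) (hc : HasCompactSupport ζ)
    {ρ : ℕ → ContDiffBump (0 : RN N)} (hρ : Tendsto (fun n => (ρ n).rOut) atTop (𝓝 0)) :
    Tendsto (fun n => ∫ x, |v x| ^ (r - 2) * v x *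
        (convolution ((ρ n).normed volume) v (lsmul ℝ ℝ) volume x * ζ x))
      atTop (𝓝 (∫ x, |v x| ^ r * ζ x)) := by
  have hconj := holderConjugate_ofReal (r := r) (by linarith)
  have hG := memLp_mul_of_hasCompactSupport (fun K hK => (hv K hK).abs_rpow_mul_self hr) hζ hc
  have hG1 : Integrable (fun x => |v x| ^ (r - 2) * v x * ζ x) := by
    have := (locallyIntegrable_of_memLp_restrict (ENNReal.HolderConjugate.one_le _
      (ENNReal.ofReal r)) fun K hK => (hv K hK).abs_rpow_mul_self hr)
    exact this.integrable_smul_right_of_hasCompactSupport hζ hc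
  obtain ⟨R, hR⟩ := hc.isCompact.isBounded.subset_closedBall (0 : RN N)
  set K := Metric.closedBall (0 : RN N) (R + 1) with hKdef
  have hKc : IsCompact K := isCompact_closedBall _ _
  have hKm : MeasurableSet K := hKc.measurableSet
  have hh : MemLp (K.indicator v) (ENNReal.ofReal r) volume :=
    (memLp_indicator_iff_restrict hKm).2 (hv K hKc)
  have hh1 : Integrable (K.indicator v) volume := by
    have := locallyIntegrable_of_memLp_restrict (ENNReal.HolderConjugate.one_le _
      (ENNReal.ofReal (r / (r - 1)))) hv
    exact (integrable_indicator_iff hKm).2 (this.integrableOn_isCompact hKc)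
  have hmem : ∀ x, ζ x ≠ 0 → ‖x‖ ≤ R := fun x hx => by
    simpa using hR (subset_tsupport _ hx)
  have key := tendsto_integral_mul_normed_convolution ENNReal.ofReal_ne_top hG hh hG1 hh1 hρ
  have hlim : ∫ x, |v x| ^ (r - 2) * v x * ζ x * K.indicator v x = ∫ x, |v x| ^ r * ζ x := by
    refine integral_congr_ae (Eventually.of_forall fun x => ?_)
    by_cases hx : ζ x = 0
    · simp [hx]
    · have hxK : x ∈ K := by
        have := hmem x hx
        simp only [hKdef, mem_closedBall_zero_iff]; linarith
      simp only [Set.indicator_of_mem hxK]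
      rw [← abs_rpow_mul_mul_self (by linarith : 0 < r)]; ring
  rw [hlim] at key
  refine key.congr' ?_
  filter_upwards [hρ.eventually (gt_mem_nhds (show (0 : ℝ) < 1 by norm_num))] with n hn
  refine integral_congr_ae (Eventually.of_forall fun x => ?_)
  by_cases hx : ζ x = 0
  · simp [hx]
  · simp only
    rw [normed_convolution_congr (ρ n) (v := K.indicator v) (w := v)]
    · ring
    · intro y hy
      refine Set.indicator_of_mem ?_ _
      have h1 := hmem x hx
      have h2 : ‖y - x‖ < (ρ n).rOut := by simpa [dist_eq_norm] using hy
      have h3 := norm_le_norm_add_norm_sub' y x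
      simp only [hKdef, mem_closedBall_zero_iff]; linarith

theorem young_cutoff {r : ℝ} (hr : 1 < r) {s : ℕ} (hs : r ≤ s) {a e B : ℝ} (ha : 0 ≤ a)
    (he : 0 ≤ e) (he1 : e ≤ 1) (hB : 0 ≤ B) :
    a ^ (r - 1) * (B * e ^ (s - 1)) ≤ a ^ r * e ^ s + B ^ r := by
  have hs1 : 1 ≤ s := by
    have : (1 : ℝ) < s := by linarith
    exact_mod_cast this.le
  have hsplit : ∀ x : ℝ, 0 ≤ x → x ^ r = x ^ (r - 1) * x := fun x hx => by
    conv_rhs => rw [← Real.rpow_one x, ← Real.rpow_mul hx, one_mul]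
    rw [← Real.rpow_add' hx (by linarith)]; ring_nf
  have hes : e ^ s = e ^ (s - 1) * e := by rw [← pow_succ, Nat.sub_add_cancel hs1]
  have hA : 0 ≤ a ^ (r - 1) := Real.rpow_nonneg ha _
  have hE : 0 ≤ e ^ (s - 1) := pow_nonneg he _
  rcases le_total B (a * e) with h | h
  · have h1 : a ^ (r - 1) * (B * e ^ (s - 1)) ≤ a ^ (r - 1) * ((a * e) * e ^ (s - 1)) := by gcongr
    have h2 : a ^ (r - 1) * ((a * e) * e ^ (s - 1)) = a ^ r * e ^ s := by
      rw [hsplit a ha, hes]; ring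
    linarith [Real.rpow_nonneg hB r]
  · have h1 : e ^ (s - 1) ≤ e ^ (r - 1) := by
      rw [← Real.rpow_natCast]
      refine Real.rpow_le_rpow_of_exponent_ge' he he1 (by linarith) ?_
      rw [Nat.cast_sub hs1]; push_cast; linarith
    have h2 : a ^ (r - 1) * (B * e ^ (s - 1)) ≤ a ^ (r - 1) * (B * e ^ (r - 1)) := by gcongr
    have h3 : a ^ (r - 1) * (B * e ^ (r - 1)) = (a * e) ^ (r - 1) * B := by
      rw [Real.mul_rpow ha he]; ring
    have h4 : (a * e) ^ (r - 1) * B ≤ B ^ (r - 1) * B := by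
      gcongr
    rw [← hsplit B hB] at h4
    have := mul_nonneg (Real.rpow_nonneg ha r) (pow_nonneg he s)
    linarith

theorem continuous_partialDeriv {N : ℕ} (i : Fin N) {φ : RN N → ℝ} (hφ : ContDiff ℝ 1 φ) :
    Continuous (partialDeriv i φ) :=
  (hφ.continuous_fderiv one_ne_zero).clm_apply continuous_const

theorem hasCompactSupport_partialDeriv {N : ℕ} (i : Fin N) {φ : RN N → ℝ}
    (hφ : HasCompactSupport φ) : HasCompactSupport (partialDeriv i φ) :=
  hφ.fderiv_apply (𝕜 := ℝ) _

/-- Testing `-div A = G` against `(u + 1) ζ`, where `G ≤ -c`, with `u` mollified. -/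
theorem flux_mollified_le {N : ℕ} {A Du : Fin N → RN N → ℝ} {G u : RN N → ℝ} {c M : ℝ}
    (hA : ∀ i, LocallyIntegrable (A i) volume) (hu : LocallyIntegrable u volume)
    (hDu : ∀ i, IsWeakPartialDeriv i u (Du i)) (h0 : ∀ᵐ x, 0 < u x) (hM : ∀ᵐ x, u x ≤ M)
    (hc : 0 ≤ c)
    (hG : LocallyIntegrable G volume) (hGc : ∀ᵐ x, G x ≤ -c)
    (hweak : ∀ φ : RN N → ℝ, ContDiff ℝ 1 φ → HasCompactSupport φ →
      ∑ i, ∫ x, A i x * partialDeriv i φ x = ∫ x, G x * φ x)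
    {ζ : RN N → ℝ} (hζ : ContDiff ℝ 1 ζ) (hζc : HasCompactSupport ζ) (hζ0 : ∀ x, 0 ≤ ζ x)
    (ρ : ContDiffBump (0 : RN N)) :
    (∑ i, ∫ x, A i x * (convolution (ρ.normed volume) (Du i) (lsmul ℝ ℝ) volume x * ζ x)) +
      c * ∫ x, ζ x ≤ ∑ i, ∫ x, (M + 1) * (|A i x| * |partialDeriv i ζ x|) := by
  set m : RN N → ℝ := convolution (ρ.normed volume) u (lsmul ℝ ℝ) volume with hm
  have hmC : ContDiff ℝ 1 m :=
    ρ.hasCompactSupport_normed.contDiff_convolution_left (n := 1) _ ρ.contDiff_normed hu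
  have hmI : ∀ x, m x ∈ Set.Icc 0 M := normed_convolution_mem_Icc ρ hu h0 hM
  have hφC : ContDiff ℝ 1 fun x => (m x + 1) * ζ x := (hmC.add contDiff_const).mul hζ
  have hφc : HasCompactSupport fun x => (m x + 1) * ζ x := hζc.mul_left
  have hpd : ∀ i x, partialDeriv i (fun x => (m x + 1) * ζ x) x =
      convolution (ρ.normed volume) (Du i) (lsmul ℝ ℝ) volume x * ζ x +
        (m x + 1) * partialDeriv i ζ x := by
    intro i x
    rw [← partialDeriv_normed_convolution ρ (hDu i) x]
    have h1 : DifferentiableAt ℝ m x := hmC.differentiable one_ne_zero x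
    have h2 : DifferentiableAt ℝ ζ x := hζ.differentiable one_ne_zero x
    simp only [partialDeriv]
    rw [((h1.hasFDerivAt.add_const 1).fun_mul h2.hasFDerivAt).fderiv]
    simp only [add_apply, smul_apply, smul_eq_mul, ← hm]
    ring
  have hw := hweak _ hφC hφc
  have hint1 : ∀ i, Integrable fun x =>
      A i x * (convolution (ρ.normed volume) (Du i) (lsmul ℝ ℝ) volume x * ζ x) := by
    intro i
    refine (hA i).integrable_smul_right_of_hasCompactSupport ?_ hζc.mul_left
    refine Continuous.mul ?_ hζ.continuous
    exact ρ.hasCompactSupport_normed.continuous_convolution_left _ ρ.continuous_normed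
      (hDu i).2.1
  have hpc := fun i => continuous_partialDeriv i hζ
  have hps := fun i => hasCompactSupport_partialDeriv i hζc
  have hint2 : ∀ i, Integrable fun x => A i x * ((m x + 1) * partialDeriv i ζ x) := fun i =>
    (hA i).integrable_smul_right_of_hasCompactSupport
      ((hmC.continuous.add continuous_const).mul (hpc i)) (hps i).mul_left
  have hint3 : ∀ i, Integrable fun x => (M + 1) * (|A i x| * |partialDeriv i ζ x|) := by
    intro i
    have := ((hA i).integrable_smul_right_of_hasCompactSupport (hpc i) (hps i)).abs.const_mul
      (M + 1)
    simpa only [smul_eq_mul, abs_mul] using this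
  have hterm : ∀ i,
      ∫ x, A i x * (convolution (ρ.normed volume) (Du i) (lsmul ℝ ℝ) volume x * ζ x) ≤
      (∫ x, A i x * partialDeriv i (fun x => (m x + 1) * ζ x) x) +
        ∫ x, (M + 1) * (|A i x| * |partialDeriv i ζ x|) := by
    intro i
    have h1 : ∫ x, A i x * partialDeriv i (fun x => (m x + 1) * ζ x) x =
        (∫ x, A i x * (convolution (ρ.normed volume) (Du i) (lsmul ℝ ℝ) volume x * ζ x)) +
        ∫ x, A i x * ((m x + 1) * partialDeriv i ζ x) := by
      rw [← integral_add (hint1 i) (hint2 i)]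
      simp only [hpd, mul_add]
    have h2 : -∫ x, (M + 1) * (|A i x| * |partialDeriv i ζ x|) ≤
        ∫ x, A i x * ((m x + 1) * partialDeriv i ζ x) := by
      rw [← integral_neg]
      refine integral_mono (hint3 i).neg (hint2 i) fun x => ?_
      have h3 : |A i x * ((m x + 1) * partialDeriv i ζ x)| ≤
          (M + 1) * (|A i x| * |partialDeriv i ζ x|) := by
        have h4 := hmI x
        rw [abs_mul, abs_mul, abs_of_nonneg (by linarith [h4.1] : 0 ≤ m x + 1)]
        have := mul_le_mul_of_nonneg_right (by linarith [h4.2] : m x + 1 ≤ M + 1)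
          (mul_nonneg (abs_nonneg (A i x)) (abs_nonneg (partialDeriv i ζ x)))
        linarith
      exact (abs_le.1 h3).1
    linarith
  have hrhs : ∫ x, G x * ((m x + 1) * ζ x) ≤ -(c * ∫ x, ζ x) := by
    rw [← integral_const_mul, ← integral_neg]
    refine integral_mono_ae (hG.integrable_smul_right_of_hasCompactSupport hφC.continuous hφc)
      ((hζ.continuous.integrable_of_hasCompactSupport hζc).const_mul c).neg ?_
    filter_upwards [hGc] with x hx
    have h4 := (hmI x).1
    have h5 := mul_nonneg h4 (hζ0 x)
    have h6 := mul_le_mul_of_nonneg_right hx (add_nonneg h5 (hζ0 x))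
    nlinarith [mul_nonneg hc h5]
  have hsum := Finset.sum_le_sum fun i (_ : i ∈ Finset.univ) => hterm i
  rw [Finset.sum_add_distrib, hw] at hsum
  linarith

theorem energy_le {N : ℕ} {p : Fin N → ℝ} (hp : ∀ i, 2 < p i) {Du : Fin N → RN N → ℝ}
    {G u : RN N → ℝ} {c M : ℝ} (hu : HasAnisoGradient p u Du)
    (h0 : ∀ᵐ x, 0 < u x) (hM : ∀ᵐ x, u x ≤ M) (hc : 0 ≤ c)
    (hG : LocallyIntegrable G volume) (hGc : ∀ᵐ x, G x ≤ -c)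
    (hweak : ∀ φ : RN N → ℝ, ContDiff ℝ 1 φ → HasCompactSupport φ →
      ∑ i, ∫ x, |Du i x| ^ (p i - 2) * Du i x * partialDeriv i φ x = ∫ x, G x * φ x)
    {ζ : RN N → ℝ} (hζ : ContDiff ℝ 1 ζ) (hζc : HasCompactSupport ζ) (hζ0 : ∀ x, 0 ≤ ζ x) :
    (∑ i, ∫ x, |Du i x| ^ p i * ζ x) + c * ∫ x, ζ x ≤
      ∑ i, ∫ x, (M + 1) * (|Du i x| ^ (p i - 1) * |partialDeriv i ζ x|) := by
  have hA : ∀ i, LocallyIntegrable (fun x => |Du i x| ^ (p i - 2) * Du i x) volume := by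
    intro i
    have := holderConjugate_ofReal (r := p i) (by linarith [hp i])
    exact locallyIntegrable_of_memLp_restrict
      (ENNReal.HolderConjugate.one_le _ (ENNReal.ofReal (p i)))
      fun K hK => ((hu.2 i).2 K hK).abs_rpow_mul_self (hp i)
  have habs : ∀ i x, |(|Du i x| ^ (p i - 2) * Du i x)| = |Du i x| ^ (p i - 1) := by
    intro i x
    rw [abs_mul, Real.abs_rpow_of_nonneg (abs_nonneg _), abs_abs]
    rcases eq_or_ne (Du i x) 0 with h | h
    · rw [h, abs_zero, mul_zero, Real.zero_rpow (by linarith [hp i])]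
    · rw [← Real.rpow_add_one (abs_ne_zero.2 h)]; ring_nf
  obtain ⟨ρ, hρ⟩ : ∃ ρ : ℕ → ContDiffBump (0 : RN N),
      Tendsto (fun n => (ρ n).rOut) atTop (𝓝 0) := by
    refine ⟨fun n => ⟨1 / ((n : ℝ) + 1) / 2, 1 / ((n : ℝ) + 1), by positivity,
      half_lt_self (by positivity)⟩, tendsto_one_div_add_atTop_nhds_zero_nat⟩
  have key := fun n => flux_mollified_le hA hu.1 (fun i => (hu.2 i).1) h0 hM hc hG hGc hweak
    hζ hζc hζ0 (ρ n)
  simp only [habs] at key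
  have hlim := (tendsto_finsetSum Finset.univ fun i _ => tendsto_integral_flux_mul_normed_convolution (hp i)
    (hu.2 i).2 hζ.continuous hζc hρ).add_const (c * ∫ x, ζ x)
  exact le_of_tendsto hlim (Eventually.of_forall key)

theorem cutoff_inequality {N : ℕ} {p : Fin N → ℝ} (hp : ∀ i, 2 < p i) {Du : Fin N → RN N → ℝ}
    {G u : RN N → ℝ} {c M : ℝ} (hu : HasAnisoGradient p u Du)
    (h0 : ∀ᵐ x, 0 < u x) (hM : ∀ᵐ x, u x ≤ M) (hM0 : 0 ≤ M) (hc : 0 ≤ c)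
    (hG : LocallyIntegrable G volume) (hGc : ∀ᵐ x, G x ≤ -c)
    (hweak : ∀ φ : RN N → ℝ, ContDiff ℝ 1 φ → HasCompactSupport φ →
      ∑ i, ∫ x, |Du i x| ^ (p i - 2) * Du i x * partialDeriv i φ x = ∫ x, G x * φ x)
    {η : RN N → ℝ} (hη : ContDiff ℝ 1 η) (hηc : HasCompactSupport η) (hη0 : ∀ x, 0 ≤ η x)
    (hη1 : ∀ x, η x ≤ 1) {s : ℕ} (hs : ∀ i, p i ≤ s) (hs0 : s ≠ 0) :
    c * ∫ x, η x ^ s ≤ ∑ i, ((M + 1) * s) ^ p i * ∫ x, |partialDeriv i η x| ^ p i := by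
  have hζ : ContDiff ℝ 1 fun x => η x ^ s := hη.pow s
  have hζc : HasCompactSupport fun x => η x ^ s := hηc.comp_left (zero_pow hs0)
  have key := energy_le hp hu h0 hM hc hG hGc hweak hζ hζc fun x => pow_nonneg (hη0 x) s
  have hpd : ∀ i x, |partialDeriv i (fun x => η x ^ s) x| =
      s * η x ^ (s - 1) * |partialDeriv i η x| := by
    intro i x
    have h2 : DifferentiableAt ℝ η x := hη.differentiable one_ne_zero x
    simp only [partialDeriv]
    rw [(h2.hasFDerivAt.pow s).fderiv]
    simp [abs_mul, abs_of_nonneg (hη0 x)]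
  have hterm : ∀ i, ∫ x, (M + 1) * (|Du i x| ^ (p i - 1) * |partialDeriv i (fun x => η x ^ s) x|) ≤
      (∫ x, |Du i x| ^ p i * η x ^ s) +
        ((M + 1) * s) ^ p i * ∫ x, |partialDeriv i η x| ^ p i := by
    intro i
    have hpi : 0 < p i := by linarith [hp i]
    have hi1 : Integrable fun x => |Du i x| ^ p i * η x ^ s := by
      have hL : LocallyIntegrable (fun x => |Du i x| ^ p i) volume := by
        rw [locallyIntegrable_iff]
        intro K hK
        have := ((hu.2 i).2 K hK).integrable_norm_rpow (by simpa using hpi) ENNReal.ofReal_ne_top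
        simpa only [ENNReal.toReal_ofReal hpi.le, Real.norm_eq_abs, IntegrableOn] using this
      exact hL.integrable_smul_right_of_hasCompactSupport hζ.continuous hζc
    have hi2 : Integrable fun x => |partialDeriv i η x| ^ p i :=
      ((continuous_partialDeriv i hη).abs.rpow_const fun _ => Or.inr hpi.le).integrable_of_hasCompactSupport
        ((hasCompactSupport_partialDeriv i hηc).comp_left (g := fun t => |t| ^ p i)
          (by simp [Real.zero_rpow hpi.ne']))
    rw [← integral_const_mul, ← integral_add hi1 (hi2.const_mul _)]
    refine integral_mono_of_nonneg
      (Eventually.of_forall fun x => by simp only [Pi.zero_apply]; positivity) (hi1.add (hi2.const_mul _))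
      (Eventually.of_forall fun x => ?_)
    have hy := young_cutoff (by linarith [hp i] : 1 < p i) (hs i) (abs_nonneg (Du i x)) (hη0 x)
      (hη1 x) (by positivity : 0 ≤ (M + 1) * s * |partialDeriv i η x|)
    rw [Real.mul_rpow (by positivity) (abs_nonneg _)] at hy
    simp only [hpd]
    refine le_trans (le_of_eq ?_) hy
    ring
  have hsum := Finset.sum_le_sum fun i (_ : i ∈ Finset.univ) => hterm i
  rw [Finset.sum_add_distrib] at hsum
  linarith

theorem partialDeriv_comp_smul {N : ℕ} (i : Fin N) {η : RN N → ℝ} (hη : ContDiff ℝ 1 η) (a : ℝ)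
    (x : RN N) : partialDeriv i (fun x => η (a • x)) x = a * partialDeriv i η (a • x) := by
  have h1 : DifferentiableAt ℝ η (a • x) := hη.differentiable one_ne_zero _
  have h2 := h1.hasFDerivAt.comp x ((hasFDerivAt_id x).const_smul a)
  simp only [partialDeriv]
  rw [HasFDerivAt.fderiv (f := fun x => η (a • x)) h2]
  simp

/-- There is no bounded positive `u` on `ℝᴺ` with `∑ᵢ ∂ᵢ (|∂ᵢ u|^(pᵢ - 2) ∂ᵢ u) ≥ c > 0`. -/
theorem not_bounded_of_anisotropic_laplacian_ge {N : ℕ} {p : Fin N → ℝ} (hp : ∀ i, 2 < p i)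
    {Du : Fin N → RN N → ℝ} {G u : RN N → ℝ} {c M : ℝ} (hu : HasAnisoGradient p u Du)
    (h0 : ∀ᵐ x, 0 < u x) (hM : ∀ᵐ x, u x ≤ M) (hM0 : 0 ≤ M) (hc : 0 < c)
    (hG : LocallyIntegrable G volume) (hGc : ∀ᵐ x, G x ≤ -c) :
    ¬ ∀ φ : RN N → ℝ, ContDiff ℝ 1 φ → HasCompactSupport φ →
      ∑ i, ∫ x, |Du i x| ^ (p i - 2) * Du i x * partialDeriv i φ x = ∫ x, G x * φ x := by
  intro hweak
  obtain ⟨s, hs0, hs⟩ : ∃ s : ℕ, s ≠ 0 ∧ ∀ i, p i ≤ s := by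
    obtain ⟨s, hs⟩ := exists_nat_ge (∑ i, p i)
    refine ⟨s + 1, s.succ_ne_zero, fun i => ?_⟩
    have := Finset.single_le_sum (f := p) (fun j _ => by linarith [hp j]) (Finset.mem_univ i)
    push_cast
    linarith
  let b : ContDiffBump (0 : RN N) := ⟨1, 2, one_pos, one_lt_two⟩
  have hb : ContDiff ℝ 1 b := b.contDiff
  have hscaled : ∀ n : ℕ, c * ∫ x, b x ^ s ≤
      ∑ i, ((M + 1) * s) ^ p i * ((∫ x, |partialDeriv i b x| ^ p i) *
        ((n : ℝ) + 1) ^ (-p i)) := by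
    intro n
    have hR : (0 : ℝ) < (n : ℝ) + 1 := by positivity
    set R : ℝ := (n : ℝ) + 1
    have h := cutoff_inequality hp hu h0 hM hM0 hc.le hG hGc hweak
      (η := fun x => b (R⁻¹ • x)) (hb.comp (contDiff_const_smul _))
      (b.hasCompactSupport.comp_homeomorph (Homeomorph.smulOfNeZero R⁻¹ (inv_ne_zero hR.ne')))
      (fun x => b.nonneg) (fun x => b.le_one) hs hs0
    simp only [partialDeriv_comp_smul _ hb] at h
    rw [Measure.integral_comp_inv_smul_of_nonneg volume (fun x => b x ^ s) hR.le] at h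
    have hi : ∀ i, ∫ x, |R⁻¹ * partialDeriv i b (R⁻¹ • x)| ^ p i =
        R ^ Module.finrank ℝ (RN N) * ((∫ x, |partialDeriv i b x| ^ p i) * R ^ (-p i)) := by
      intro i
      have h1 : ∀ x, |R⁻¹ * partialDeriv i b (R⁻¹ • x)| ^ p i =
          R ^ (-p i) * |partialDeriv i b (R⁻¹ • x)| ^ p i := by
        intro x
        rw [abs_mul, Real.mul_rpow (abs_nonneg _) (abs_nonneg _), abs_of_pos (inv_pos.2 hR),
          Real.inv_rpow hR.le, Real.rpow_neg hR.le]
      simp only [h1]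
      rw [integral_const_mul, Measure.integral_comp_inv_smul_of_nonneg volume
        (fun x => |partialDeriv i b x| ^ p i) hR.le, smul_eq_mul]
      ring
    simp only [hi, smul_eq_mul] at h
    have hRN : 0 < R ^ Module.finrank ℝ (RN N) := by positivity
    refine le_of_mul_le_mul_left ?_ hRN
    rw [Finset.mul_sum]
    simpa only [mul_left_comm] using h
  have hlim : Tendsto (fun n : ℕ => ∑ i, ((M + 1) * s) ^ p i *
      ((∫ x, |partialDeriv i b x| ^ p i) * ((n : ℝ) + 1) ^ (-p i))) atTop (𝓝 0) := by
    have hz : ∀ i, Tendsto (fun n : ℕ => ((n : ℝ) + 1) ^ (-p i)) atTop (𝓝 0) := fun i =>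
      (tendsto_rpow_neg_atTop (by linarith [hp i] : 0 < p i)).comp
        (tendsto_atTop_add_const_right _ _ tendsto_natCast_atTop_atTop)
    have := tendsto_finsetSum Finset.univ fun i _ =>
      ((hz i).const_mul (∫ x, |partialDeriv i b x| ^ p i)).const_mul (((M + 1) * s) ^ p i)
    simpa using this
  have hle : c * ∫ x, b x ^ s ≤ 0 := ge_of_tendsto hlim (Eventually.of_forall hscaled)
  have hpos : 0 < ∫ x, b x ^ s := by
    refine (b.continuous.pow s).integral_pos_of_hasCompactSupport_nonneg_nonzero
      (b.hasCompactSupport.comp_left (g := (· ^ s)) (zero_pow hs0))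
      (fun x => pow_nonneg b.nonneg s) (x := 0) ?_
    simp [b.one_of_mem_closedBall (Metric.mem_closedBall_self b.rIn_pos.le)]
  exact absurd (mul_pos hc hpos) hle.not_gt

/-- The exponents are `p 0 ≤ … ≤ p (N - 1)`, that is, `p₁ ≤ … ≤ p_N` numbered from `0`. -/
theorem theorem3p5 (N : ℕ) (hN : 1 ≤ N) (p : Fin N → ℝ)
    (hp : ∀ i, 2 < p i) (hmono : Monotone p)
    (g : RN N → ℝ) (hg : LocallyIntegrable g volume)
    (c : ℝ) (hc : 0 < c) (hgc : ∀ᵐ x, c ≤ g x)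
    (M : ℝ) (hM : M ∈ intervalJ N (meanExponent p) (p ⟨N - 1, by omega⟩))
    (u : RN N → ℝ) (hu : u ∈ AnisoSobolevLoc p)
    (hpos : ∀ᵐ x, 0 < u x) (hle : ∀ᵐ x, u x ≤ M) :
    ¬ IsStableSolution p g negExpInv u := by
  rintro ⟨Du, hDu, -, hG, -, hweak, -⟩
  refine not_bounded_of_anisotropic_laplacian_ge hp hDu hpos hle hM.1.1.le hc hG ?_ hweak
  filter_upwards [hgc, hpos] with x hx hux
  have h1 : 1 ≤ Real.exp (1 / u x) := Real.one_le_exp (by positivity)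
  simp only [negExpInv, mul_neg, neg_le_neg_iff]
  exact hx.trans (le_mul_of_one_le_right (hc.le.trans hx) h1)
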